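/- Let $m_1,m_2,m_3,l_1,l_2,l_3>0$, $k_1>0$ and $F\in\mathbb{R}$, and put $$A_{11}=m_1l_1^2+m_3l_3^2,\qquad A_{12}=A_{21}=m_1l_1^2+m_3l_3^2+(m_1l_1-m_3l_3)\,l_2\cos\varphi_1,$$ $$A_{22}=(m_1+m_2+m_3)\,l_2^2+m_1l_1^2+m_3l_3^2+2(m_1l_1-m_3l_3)\,l_2\cos\varphi_1,$$ $$r_1=-k_1\varphi_1-(m_1l_1-m_3l_3)\,l_2v_2^2\sin\varphi_1,\qquad r_2=-Fl_1\sin\varphi_1+(m_1l_1-m_3l_3)\,l_2v_1(v_1+2v_2)\sin\varphi_1 .$$ The reduced equations of motion of the Ziegler pendulum without a spring at the fixed pivot ($k_2=0$) are the system $$\dot\varphi_1=v_1,\qquad \dot v_1=\Bigl(r_1-\frac{A_{12}}{A_{22}}r_2\Bigr)\Bigl(A_{11}-\frac{A_{12}A_{21}}{A_{22}}\Bigr)^{-1},\qquad \dot v_2=\Bigl(r_2-\frac{A_{21}}{A_{11}}r_1\Bigr)\Bigl(A_{22}-\frac{A_{12}A_{21}}{A_{11}}\Bigr)^{-1}$$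 for $(\varphi_1,v_1,v_2)\in\mathbb{R}^3$. **Proposition.** For every $k_1>0$ there is $\varepsilon=\varepsilon(k_1)>0$ such that for all $m_1,m_2,m_3,l_1,l_2,l_3>0$ and all $F\in\mathbb{R}$ with $|m_1l_1-m_3l_3|<\varepsilon$ this system has a two-parameter family of periodic solutions. Here a two-parameter family of periodic solutions of a system $\dot x=X(x)$ in $\mathbb{R}^3$ consists of a nonempty open set $U\subset\mathbb{R}^2$ and, for each $s\in U$, a nonconstant periodic solution $\gamma_s:\mathbb{R}\to\mathbb{R}^3$ with least period $T(s)>0$, such that $\gamma_s(t)$ is continuous in $(s,t)\in U\times\mathbb{R}$, $T$ is continuous, the map $s\mapsto\gamma_s(0)$ is a $C^\infty$ immersion of $U$ to whose image $X$ is nowhere tangent, and the orbits $\gamma_s(\mathbb{R})$ and $\gamma_{s'}(\mathbb{R})$ are disjoint for $s\neq s'$. -/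

import Mathlib

open Real Set
open scoped ContDiff

noncomputable section

namespace ZieglerPendulum

/-- Entry `A₁₁` of the mass matrix. -/
def massA11 (m₁ m₃ l₁ l₃ : ℝ) : ℝ := m₁ * l₁ ^ 2 + m₃ * l₃ ^ 2

/-- Entry `A₁₂ = A₂₁` of the mass matrix at the angle `φ`. -/
def massA12 (m₁ m₃ l₁ l₂ l₃ φ : ℝ) : ℝ :=
  m₁ * l₁ ^ 2 + m₃ * l₃ ^ 2 + m₁ * l₁ * l₂ * cos φ - m₃ * l₂ * l₃ * cos φ

/-- Entry `A₂₂` of the mass matrix at the angle `φ`. -/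
def massA22 (m₁ m₂ m₃ l₁ l₂ l₃ φ : ℝ) : ℝ :=
  m₁ * l₂ ^ 2 + m₁ * l₁ ^ 2 + m₂ * l₂ ^ 2 + m₃ * l₂ ^ 2 + m₃ * l₃ ^ 2
    + 2 * m₁ * l₁ * l₂ * cos φ - 2 * m₃ * l₂ * l₃ * cos φ

/-- First right-hand side `r₁`, as a function of `φ = φ₁` and `v₂ = φ₂'`. -/
def rhs1 (m₁ m₃ l₁ l₂ l₃ k₁ φ v₂ : ℝ) : ℝ :=
  -k₁ * φ - m₁ * l₁ * l₂ * v₂ ^ 2 * sin φ + m₃ * l₂ * l₃ * v₂ ^ 2 * sin φ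

/-- Second right-hand side `r₂` for `k₂ = 0`, as a function of `φ = φ₁`, `v₁ = φ₁'` and
`v₂ = φ₂'`. -/
def rhs2 (m₁ m₃ l₁ l₂ l₃ F φ v₁ v₂ : ℝ) : ℝ :=
  -F * l₁ * sin φ + m₁ * l₁ * l₂ * v₁ * (v₁ + 2 * v₂) * sin φ
    - m₃ * l₂ * l₃ * v₁ * (v₁ + 2 * v₂) * sin φ

/-- The vector field, on the space of the triples `(φ₁, v₁, v₂)`, of the reduced equations of
motion of the Ziegler pendulum whose fixed pivot carries no spring (`k₂ = 0`). -/
def reducedField (m₁ m₂ m₃ l₁ l₂ l₃ k₁ F : ℝ) (p : ℝ × ℝ × ℝ) : ℝ × ℝ × ℝ :=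
  let φ := p.1
  let v₁ := p.2.1
  let v₂ := p.2.2
  let A₁₁ := massA11 m₁ m₃ l₁ l₃
  let A₁₂ := massA12 m₁ m₃ l₁ l₂ l₃ φ
  let A₂₂ := massA22 m₁ m₂ m₃ l₁ l₂ l₃ φ
  let r₁ := rhs1 m₁ m₃ l₁ l₂ l₃ k₁ φ v₂
  let r₂ := rhs2 m₁ m₃ l₁ l₂ l₃ F φ v₁ v₂
  (v₁,
    (r₁ - A₁₂ / A₂₂ * r₂) * (A₁₁ - A₁₂ * A₁₂ / A₂₂)⁻¹,
    (r₂ - A₁₂ / A₁₁ * r₁) * (A₂₂ - A₁₂ * A₁₂ / A₁₁)⁻¹)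

end ZieglerPendulum

/-- The autonomous system `x' = X x` in a three-dimensional space has a two-parameter family of
periodic solutions: there are a nonempty open set `U` of parameters in the plane and, for every
`s ∈ U`, a nonconstant periodic solution `γ s`, defined for all times, with least period `T s`,
such that `γ s t` is jointly continuous in `(s, t)` and `T` is continuous, the initial points
`γ s 0` form a smoothly parametrized immersed surface to which `X` is nowhere tangent (so that
both parameters are essential and neither of them is a shift of time), and different parameters
give disjoint orbits. -/
def HasTwoParameterFamilyOfPeriodicSolutions (X : ℝ × ℝ × ℝ → ℝ × ℝ × ℝ) : Prop :=
  ∃ (U : Set (ℝ × ℝ)) (γ : ℝ × ℝ → ℝ → ℝ × ℝ × ℝ) (T : ℝ × ℝ → ℝ),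
    IsOpen U ∧ U.Nonempty ∧
    (∀ s ∈ U, IsIntegralCurve (γ s) (fun _ => X) ∧
      0 < T s ∧ Function.Periodic (γ s) (T s) ∧ ∀ t ∈ Ioo 0 (T s), γ s t ≠ γ s 0) ∧
    ContinuousOn (fun q : (ℝ × ℝ) × ℝ => γ q.1 q.2) (U ×ˢ univ) ∧
    ContinuousOn T U ∧
    ContDiffOn ℝ ∞ (fun s => γ s 0) U ∧
    (∀ s ∈ U, ∀ (a : ℝ × ℝ) (c : ℝ),
      fderiv ℝ (fun s' => γ s' 0) s a + c • X (γ s 0) = 0 → a = 0 ∧ c = 0) ∧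
    (∀ s ∈ U, ∀ s' ∈ U, s ≠ s' → Disjoint (range (γ s)) (range (γ s')))

end

/-!
The reduced field of the pendulum is reversible: the reflection `φ ↦ -φ` turns solutions into
solutions run backwards. An orbit that starts on the plane `φ = 0` and meets this plane again is
therefore periodic, and a first return with nonzero speed persists under changes of the initial
point. So it suffices to find an open set of points of the plane whose orbits return; the two
coordinates `(v₁, v₂)` on this set are the parameters
(`hasTwoParameterFamilyOfPeriodicSolutions_of_isReversible`).

Returns come from a large initial velocity of the relative angle. Let `a = A₁₁`,
`b = (m₁ l₁ - m₃ l₃) l₂`, `f = F l₁`, let `det` be the determinant of the mass matrix, and let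
`ρ² = det / A₂₂` be the effective mass of the relative angle. The angular momentum
`J = A₁₂ v₁ + A₂₂ v₂` satisfies `J' = -f sin φ`, so it stays bounded for bounded times, however
large `v₁` may be. With `p = ρ v₁` the equations for the angle become
`φ' = p / ρ`, `p' = (-k φ + B) / ρ`, where `B = sin φ (f A₁₂ / A₂₂ - b J² / A₂₂²)` depends on the
velocities through `J` only (`ZieglerPendulum.hasDerivAt_rootMass_mul`). Measured by a clock of
speed `1 / ρ` this is a harmonic oscillator with a bounded force. If `J` starts near `0` and `v₁`
starts large, the force cannot prevent the oscillator from becoming negative within three quarters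
of a turn (`ZieglerPendulum.exists_pendulum_estimates`). This works for all values of the
parameters, since `det` is positive by the Cauchy-Schwarz inequality.

As the field grows quadratically in the velocities, its flow is built from a cut-off. The
estimates hold uniformly for all multiples of the field by functions with values in `[0, 1]`, and
so the orbits in question stay where the cut-off is `1`.
-/

/-! ### Flows of bounded Lipschitz vector fields -/

section Flow

variable {E : Type*} [NormedAddCommGroup E] [NormedSpace ℝ E] {Z : E → E} {K : NNReal}

theorem IsIntegralCurve.eq_of_lipschitzWith (hZ : LipschitzWith K Z) {γ η : ℝ → E}
    (hγ : IsIntegralCurve γ fun _ => Z) (hη : IsIntegralCurve η fun _ => Z) {t₀ : ℝ}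
    (h : γ t₀ = η t₀) : γ = η :=
  ODE_solution_unique_univ (v := fun _ => Z) (s := fun _ => univ) (fun _ => hZ.lipschitzOnWith)
    (fun t => ⟨hγ t, mem_univ _⟩) (fun t => ⟨hη t, mem_univ _⟩) h

theorem IsIntegralCurve.reverse {γ : ℝ → E} (hγ : IsIntegralCurve γ fun _ => Z) :
    IsIntegralCurve (fun t => γ (-t)) fun _ x => -Z x := fun t => by
  simpa [Function.comp_def] using (hγ (-t)).scomp t (hasDerivAt_neg t)

theorem IsIntegralCurve.shift {γ : ℝ → E} (hγ : IsIntegralCurve γ fun _ => Z) (a : ℝ) :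
    IsIntegralCurve (fun t => γ (t + a)) fun _ => Z :=
  hγ.comp_add a

theorem IsIntegralCurve.dist_le_of_nonneg (hZ : LipschitzWith K Z) {γ η : ℝ → E}
    (hγ : IsIntegralCurve γ fun _ => Z) (hη : IsIntegralCurve η fun _ => Z) {t : ℝ}
    (ht : 0 ≤ t) : dist (γ t) (η t) ≤ dist (γ 0) (η 0) * exp (K * t) := by
  simpa using dist_le_of_trajectories_ODE (v := fun _ => Z) (fun _ => hZ)
    hγ.continuous.continuousOn (fun s _ => (hγ s).hasDerivWithinAt)
    hη.continuous.continuousOn (fun s _ => (hη s).hasDerivWithinAt) le_rfl t ⟨ht, le_rfl⟩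

theorem IsIntegralCurve.dist_le (hZ : LipschitzWith K Z) {γ η : ℝ → E}
    (hγ : IsIntegralCurve γ fun _ => Z) (hη : IsIntegralCurve η fun _ => Z) (t : ℝ) :
    dist (γ t) (η t) ≤ dist (γ 0) (η 0) * exp (K * |t|) := by
  rcases le_total 0 t with ht | ht
  · simpa [abs_of_nonneg ht] using hγ.dist_le_of_nonneg hZ hη ht
  · have hZ' : LipschitzWith K fun x => -Z x := hZ.neg
    simpa [abs_of_nonpos ht] using
      hγ.reverse.dist_le_of_nonneg hZ' hη.reverse (neg_nonneg.2 ht)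

/-- The integral curves of a Lipschitz field depend continuously on time and on the initial
point, jointly. -/
theorem continuous_uncurry_of_isIntegralCurve (hZ : LipschitzWith K Z) {Γ : E → ℝ → E}
    (hΓ : ∀ x, IsIntegralCurve (Γ x) fun _ => Z) (hΓ₀ : ∀ x, Γ x 0 = x) :
    Continuous fun q : E × ℝ => Γ q.1 q.2 := by
  rw [continuous_iff_continuousAt]
  rintro ⟨x, t⟩
  rw [ContinuousAt, tendsto_iff_dist_tendsto_zero]
  have hlim : Filter.Tendsto
      (fun q : E × ℝ => dist q.1 x * exp (K * |q.2|) + dist (Γ x q.2) (Γ x t))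
      (nhds (x, t)) (nhds 0) := by
    have hc : Continuous
        (fun q : E × ℝ => dist q.1 x * exp (K * |q.2|) + dist (Γ x q.2) (Γ x t)) := by
      have := (hΓ x).continuous
      fun_prop
    simpa using hc.tendsto (x, t)
  refine squeeze_zero (fun _ => dist_nonneg) (fun q => ?_) hlim
  refine (dist_triangle _ (Γ x q.2) _).trans ?_
  have := (hΓ q.1).dist_le hZ (hΓ x) q.2
  rw [hΓ₀, hΓ₀] at this
  linarith

/-- A bounded Lipschitz field is complete. For a bounded field the Picard-Lindelöf theorem gives a
solution on every interval `[-n, n]`, and by uniqueness these solutions fit together. -/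
theorem exists_isIntegralCurve_of_lipschitzWith_of_bounded [CompleteSpace E]
    (hZ : LipschitzWith K Z) {L : NNReal} (hL : ∀ x, ‖Z x‖ ≤ L) (x : E) :
    ∃ γ : ℝ → E, γ 0 = x ∧ IsIntegralCurve γ fun _ => Z := by
  have hloc : ∀ n : NNReal, ∃ α : ℝ → E, α 0 = x ∧
      ∀ t ∈ Ioo (-(n : ℝ)) n, HasDerivAt α (Z (α t)) t := by
    intro n
    have h0 : (0 : ℝ) ∈ Icc (-(n : ℝ)) n := by simp
    have hPL : IsPicardLindelof (fun _ => Z) (⟨0, h0⟩ : Icc (-(n : ℝ)) n) x (L * n) 0 L K :=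
      { lipschitzOnWith := fun _ _ => hZ.lipschitzOnWith
        continuousOn := fun _ _ => continuousOn_const
        norm_le := fun _ _ y _ => hL y
        mul_max_le := by simp }
    obtain ⟨α, hα0, hα⟩ := hPL.exists_eq_forall_mem_Icc_hasDerivWithinAt₀
    exact ⟨α, hα0, fun t ht => (hα t (Ioo_subset_Icc_self ht)).hasDerivAt
      (Icc_mem_nhds ht.1 ht.2)⟩
  choose α hα0 hα using hloc
  have huniq : ∀ m n : NNReal, m ≤ n → EqOn (α m) (α n) (Ioo (-(m : ℝ)) m) := by
    intro m n hmn t ht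
    have hmn' : (m : ℝ) ≤ n := hmn
    have hm : (0 : ℝ) < m := by linarith [ht.1, ht.2]
    exact ODE_solution_unique_of_mem_Ioo (v := fun _ => Z) (s := fun _ => univ) (t₀ := 0)
      (fun _ _ => hZ.lipschitzOnWith) ⟨by linarith, hm⟩
      (fun r hr => ⟨hα m r hr, mem_univ _⟩)
      (fun r hr => ⟨hα n r ⟨by linarith [hr.1], by linarith [hr.2]⟩, mem_univ _⟩)
      (by rw [hα0, hα0]) ht
  refine ⟨fun t => α (‖t‖₊ + 1) t, hα0 _, fun t => ?_⟩
  have hev : (fun r => α (‖r‖₊ + 1) r) =ᶠ[nhds t] α (‖t‖₊ + 2) := by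
    filter_upwards [Metric.ball_mem_nhds t one_pos] with r hr
    have h1 : |r| ≤ |t| + 1 := by
      have := abs_sub_abs_le_abs_sub r t
      rw [Metric.mem_ball, Real.dist_eq] at hr
      linarith
    refine huniq _ _ ?_ ?_
    · rw [← NNReal.coe_le_coe]
      push_cast
      simp only [Real.norm_eq_abs]
      linarith
    · rw [mem_Ioo, ← abs_lt]
      simp
  have hd := hα (‖t‖₊ + 2) t (by rw [mem_Ioo, ← abs_lt]; simp)
  have heq := hev.eq_of_nhds
  change HasDerivAt _ (Z (α (‖t‖₊ + 1) t)) t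
  rw [heq]
  exact hd.congr_of_eventuallyEq hev

end Flow

/-! ### First return to zero -/

section FirstReturn

theorem exists_first_zero {f : ℝ → ℝ} (hf : Continuous f) {d t₁ : ℝ} (hd : HasDerivAt f d 0)
    (hd₀ : 0 < d) (hf₀ : f 0 = 0) (ht₁ : 0 ≤ t₁) (hft₁ : f t₁ < 0) :
    ∃ τ ∈ Ioo 0 t₁, f τ = 0 ∧ ∀ t ∈ Ioo 0 τ, 0 < f t := by
  have hpos : ∀ᶠ t in nhdsWithin 0 (Ioi 0), 0 < f t := by
    have h := (hasDerivAt_iff_tendsto_slope.1 hd).mono_left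
      (nhdsWithin_mono 0 (show Ioi 0 ⊆ {0}ᶜ from fun t ht => ne_of_gt ht))
    filter_upwards [h.eventually (lt_mem_nhds hd₀), self_mem_nhdsWithin] with t ht ht0
    rw [slope_def_field, hf₀, sub_zero, sub_zero] at ht
    exact (div_pos_iff_of_pos_right ht0).1 ht
  obtain ⟨δ, hδ0, hδ⟩ := mem_nhdsGT_iff_exists_Ioo_subset.1 hpos
  have hδ0 : 0 < δ := hδ0
  have ht₁0 : 0 < t₁ := ht₁.lt_of_ne fun h => by rw [← h, hf₀] at hft₁; exact lt_irrefl _ hft₁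
  have hδt : δ ≤ t₁ := by
    by_contra! h
    exact lt_asymm hft₁ (hδ ⟨ht₁0, h⟩)
  have hS : IsCompact (Icc (δ / 2) t₁ ∩ f ⁻¹' Iic 0) :=
    isCompact_Icc.inter_right (isClosed_Iic.preimage hf)
  obtain ⟨τ, ⟨⟨hτ1, hτ2⟩, hτ3⟩, hmin⟩ :=
    hS.exists_isLeast ⟨t₁, ⟨by linarith, le_rfl⟩, hft₁.le⟩
  have hτ3 : f τ ≤ 0 := hτ3
  have hτ0 : 0 < τ := by linarith
  have hpos' : ∀ t ∈ Ioo 0 τ, 0 < f t := by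
    intro t ht
    by_contra! h
    rcases lt_or_ge t δ with h1 | h1
    · exact not_lt.2 h (hδ ⟨ht.1, h1⟩)
    · exact not_lt.2 (hmin ⟨⟨by linarith, by linarith [ht.2]⟩, h⟩) ht.2
  have hτ4 : 0 ≤ f τ := by
    have hcl : τ ∈ closure (Ioo 0 τ) := by
      rw [closure_Ioo hτ0.ne]
      exact ⟨hτ0.le, le_rfl⟩
    exact closure_minimal (fun t ht => (hpos' t ht).le) (isClosed_Ici.preimage hf) hcl
  refine ⟨τ, ⟨hτ0, hτ2.lt_of_ne ?_⟩, le_antisymm hτ3 hτ4, hpos'⟩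
  rintro rfl
  exact not_lt.2 hτ4 hft₁

/-- The first positive zero of a function that leaves `0` with positive speed and comes back to
`0` with negative speed depends continuously on parameters. -/
theorem continuousOn_first_zero {P : Type*} [TopologicalSpace P] {f d : P → ℝ → ℝ}
    (hf : Continuous fun q : P × ℝ => f q.1 q.2) (hd : Continuous fun q : P × ℝ => d q.1 q.2)
    (hfd : ∀ s t, HasDerivAt (f s) (d s t) t) (hf₀ : ∀ s, f s 0 = 0) {U : Set P} {τ : P → ℝ}
    (hd₀ : ∀ s ∈ U, 0 < d s 0) (hτ₀ : ∀ s ∈ U, 0 < τ s) (hfτ : ∀ s ∈ U, f s (τ s) = 0)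
    (hpos : ∀ s ∈ U, ∀ t ∈ Ioo 0 (τ s), 0 < f s t) (hdτ : ∀ s ∈ U, d s (τ s) < 0) :
    ContinuousOn τ U := by
  intro s₀ hs₀
  have hf1 : ∀ t, Continuous fun s => f s t := fun t => by fun_prop
  refine tendsto_order.2 ⟨fun m hm => ?_, fun m hm => ?_⟩
  · -- near `s₀`, the function increases on a short initial interval and is positive on the rest
    -- of `(0, m]`
    have hnear : ∀ᶠ q : P × ℝ in nhds (s₀, 0), 0 < d q.1 q.2 :=
      hd.continuousAt.eventually (lt_mem_nhds (hd₀ s₀ hs₀))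
    rw [nhds_prod_eq] at hnear
    obtain ⟨A, hA, B, hB, hAB⟩ := Filter.eventually_prod_iff.1 hnear
    obtain ⟨δ, hδ, hδB⟩ := Metric.eventually_nhds_iff.1 hB
    have hcpt : ∀ᶠ s in nhds s₀, ∀ t ∈ Icc (δ / 2) m, 0 < f s t := by
      refine isCompact_Icc.eventually_forall_of_forall_eventually fun t ht => ?_
      exact hf.continuousAt.eventually
        (lt_mem_nhds (hpos s₀ hs₀ t ⟨by linarith [ht.1], ht.2.trans_lt hm⟩))
    filter_upwards [nhdsWithin_le_nhds hA, nhdsWithin_le_nhds hcpt, self_mem_nhdsWithin]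
      with s hsA hsc hsU
    by_contra! hτm
    have hzero := hfτ s hsU
    rcases lt_or_ge (τ s) (δ / 2) with h | h
    · have hmono : StrictMonoOn (f s) (Icc 0 (δ / 2)) := by
        refine strictMonoOn_of_deriv_pos (convex_Icc _ _)
          (fun t _ => (hfd s t).continuousAt.continuousWithinAt) fun t ht => ?_
        rw [interior_Icc] at ht
        rw [(hfd s t).deriv]
        refine hAB hsA (hδB ?_)
        rw [Real.dist_eq, sub_zero, abs_of_pos ht.1]
        linarith [ht.2]
      have := hmono ⟨le_rfl, by linarith⟩ ⟨(hτ₀ s hsU).le, h.le⟩ (hτ₀ s hsU)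
      rw [hf₀, hzero] at this
      exact lt_irrefl _ this
    · exact (hsc _ ⟨h, hτm⟩).ne' hzero
  · -- right after `τ s₀` the function at `s₀` is negative
    obtain ⟨t, htm, htneg⟩ : ∃ t ∈ Ioo (τ s₀) m, f s₀ t < 0 := by
      have h := (hasDerivAt_iff_tendsto_slope.1 (hfd s₀ (τ s₀))).mono_left
        (nhdsWithin_mono (τ s₀) (show Ioi (τ s₀) ⊆ {τ s₀}ᶜ from fun t ht => ne_of_gt ht))
      obtain ⟨t, ht, htm⟩ := ((h.eventually (gt_mem_nhds (hdτ s₀ hs₀))).and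
        (Ioo_mem_nhdsGT hm)).exists
      refine ⟨t, htm, ?_⟩
      rw [slope_def_field, hfτ s₀ hs₀, sub_zero, div_lt_iff₀ (sub_pos.2 htm.1), zero_mul] at ht
      exact ht
    have hev : ∀ᶠ s in nhds s₀, f s t < 0 := (hf1 t).continuousAt.eventually (gt_mem_nhds htneg)
    filter_upwards [nhdsWithin_le_nhds hev, self_mem_nhdsWithin] with s hs hsU
    refine lt_of_le_of_lt ?_ htm.2
    by_contra! hlt
    exact lt_asymm hs (hpos s hsU t ⟨(hτ₀ s₀ hs₀).trans htm.1, hlt⟩)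

end FirstReturn

/-! ### Symmetric periodic orbits of reversible fields -/

section Reversible

/-- The reflection `(φ, v₁, v₂) ↦ (-φ, v₁, v₂)`, as a continuous linear map. -/
def reflection : (ℝ × ℝ × ℝ) →L[ℝ] ℝ × ℝ × ℝ :=
  (-ContinuousLinearMap.fst ℝ ℝ (ℝ × ℝ)).prod (ContinuousLinearMap.snd ℝ ℝ (ℝ × ℝ))

@[simp] theorem reflection_apply (x : ℝ × ℝ × ℝ) : reflection x = (-x.1, x.2) := rfl

/-- A vector field is reversible if the reflection turns its integral curves into integral
curves run backwards. -/
def IsReversible (Z : ℝ × ℝ × ℝ → ℝ × ℝ × ℝ) : Prop :=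
  ∀ x, Z (reflection x) = -reflection (Z x)

variable {Z : ℝ × ℝ × ℝ → ℝ × ℝ × ℝ} {K : NNReal} {γ : ℝ → ℝ × ℝ × ℝ} {τ : ℝ}

theorem IsReversible.apply_sub_eq (hr : IsReversible Z) (hZ : LipschitzWith K Z)
    (hγ : IsIntegralCurve γ fun _ => Z) (hτ : (γ τ).1 = 0) (t : ℝ) :
    γ (τ - t) = reflection (γ (τ + t)) := by
  have h1 : IsIntegralCurve (fun t => reflection (γ (t + τ))) fun _ x => -Z x := fun t => by
    have := reflection.hasFDerivAt.comp_hasDerivAt t (hγ.shift τ t)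
    rwa [show reflection (Z (γ (t + τ))) = -Z (reflection (γ (t + τ))) by rw [hr, neg_neg]] at this
  have h2 : IsIntegralCurve (fun t => γ (-t + τ)) fun _ x => -Z x := (hγ.shift τ).reverse
  have h3 := h2.eq_of_lipschitzWith hZ.neg h1 (t₀ := 0) (by ext <;> simp [hτ])
  have h4 := congrFun h3 t
  rwa [neg_add_eq_sub, add_comm t τ] at h4

theorem IsReversible.periodic (hr : IsReversible Z) (hZ : LipschitzWith K Z)
    (hγ : IsIntegralCurve γ fun _ => Z) (h₀ : (γ 0).1 = 0) (hτ : (γ τ).1 = 0) :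
    Function.Periodic γ (2 * τ) := fun t => by
  have h1 := hr.apply_sub_eq hZ hγ hτ (-(t + τ))
  have h2 := hr.apply_sub_eq hZ hγ h₀ t
  rw [show τ - -(t + τ) = t + 2 * τ by ring, show τ + -(t + τ) = 0 - t by ring, h2] at h1
  rw [h1]
  ext <;> simp

/-- A field that is reversible and has no component across the plane `φ = 0` at one of its points
vanishes there; hence an orbit that crosses the plane transversally once always does. -/
theorem IsReversible.fst_ne_zero (hr : IsReversible Z) (hZ : LipschitzWith K Z)
    (hγ : IsIntegralCurve γ fun _ => Z) (h₀ : (Z (γ 0)).1 ≠ 0) (hτ : (γ τ).1 = 0) :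
    (Z (γ τ)).1 ≠ 0 := by
  intro h
  have hfix : reflection (γ τ) = γ τ := by ext <;> simp [hτ]
  have hzero : Z (γ τ) = 0 := by
    have h1 := hr (γ τ)
    rw [hfix] at h1
    have h2 := congrArg Prod.snd h1
    rw [reflection_apply, Prod.snd_neg, self_eq_neg] at h2
    exact Prod.ext h h2
  have hc : IsIntegralCurve (fun _ : ℝ => γ τ) fun _ => Z :=
    isIntegralCurve_const fun _ => hzero
  have := congrFun (hγ.eq_of_lipschitzWith hZ hc (t₀ := τ) rfl) 0
  rw [this] at h₀
  exact h₀ h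

/-- An orbit that starts upwards from the plane `φ = 0` and falls below it later is symmetric:
with `τ` its first return time, it is `2 * τ`-periodic and crosses the plane upwards only at its
initial point. -/
theorem IsReversible.exists_half_period (hr : IsReversible Z) (hZ : LipschitzWith K Z)
    (hγ : IsIntegralCurve γ fun _ => Z) (h₀ : (γ 0).1 = 0) (hup : 0 < (Z (γ 0)).1) {t₁ : ℝ}
    (ht₁ : 0 ≤ t₁) (hneg : (γ t₁).1 < 0) :
    ∃ τ ∈ Ioo 0 t₁, (γ τ).1 = 0 ∧ (∀ t ∈ Ioo 0 τ, 0 < (γ t).1) ∧ (Z (γ τ)).1 < 0 ∧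
      ∀ t ∈ Ioo 0 (2 * τ), (γ t).1 = 0 → (Z (γ t)).1 < 0 := by
  have hd : ∀ t, HasDerivAt (fun t => (γ t).1) (Z (γ t)).1 t := fun t =>
    (ContinuousLinearMap.fst ℝ ℝ (ℝ × ℝ)).hasFDerivAt.comp_hasDerivAt t (hγ t)
  obtain ⟨τ, hτ, hτ0, hpos⟩ := exists_first_zero (hγ.continuous.fst) (hd 0) hup h₀ ht₁ hneg
  have hdown : (Z (γ τ)).1 < 0 := by
    refine lt_of_le_of_ne ?_ (hr.fst_ne_zero hZ hγ hup.ne' hτ0)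
    by_contra! h
    have hs := (hasDerivAt_iff_tendsto_slope.1 (hd τ)).mono_left
      (nhdsWithin_mono τ (show Iio τ ⊆ {τ}ᶜ from fun t ht => ne_of_lt ht))
    obtain ⟨t, ht, htm⟩ := ((hs.eventually (lt_mem_nhds h)).and (Ioo_mem_nhdsLT hτ.1)).exists
    rw [slope_def_field, hτ0, sub_zero] at ht
    exact not_lt.2 (div_nonpos_of_nonneg_of_nonpos (hpos t htm).le (by linarith [htm.2])) ht
  refine ⟨τ, hτ, hτ0, hpos, hdown, fun t ht ht0 => ?_⟩
  rcases lt_trichotomy t τ with h | h | h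
  · exact absurd ht0 (hpos t ⟨ht.1, h⟩).ne'
  · rwa [h]
  · have hsym := hr.apply_sub_eq hZ hγ hτ0 (t - τ)
    have h1 := hpos (τ - (t - τ)) ⟨by linarith [ht.2], by linarith⟩
    rw [hsym, reflection_apply, show τ + (t - τ) = t by ring, ht0] at h1
    simp at h1

/-- The orbits of a reversible field `Z` that start upwards from the plane `φ = 0` and come back to
it form a two-parameter family of periodic solutions. This is stated for a field `X` that agrees
with the complete field `Z` along these orbits. -/
theorem hasTwoParameterFamilyOfPeriodicSolutions_of_isReversible
    {X : ℝ × ℝ × ℝ → ℝ × ℝ × ℝ} (hZ : LipschitzWith K Z) {L : NNReal} (hL : ∀ x, ‖Z x‖ ≤ L)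
    (hZr : IsReversible Z) (hXr : IsReversible X) {U : Set (ℝ × ℝ)} (hU : IsOpen U)
    (hUne : U.Nonempty) (hup : ∀ s ∈ U, 0 < (Z (0, s)).1) {T₀ : ℝ}
    (hT₀ : ∀ s ∈ U, ∀ γ : ℝ → ℝ × ℝ × ℝ, IsIntegralCurve γ (fun _ => Z) → γ 0 = (0, s) →
      (∀ t ∈ Icc 0 T₀, Z (γ t) = X (γ t)) ∧ ∃ t ∈ Icc 0 T₀, (γ t).1 < 0) :
    HasTwoParameterFamilyOfPeriodicSolutions X := by
  choose Γ hΓ₀ hΓ using exists_isIntegralCurve_of_lipschitzWith_of_bounded hZ hL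
  have hcont : Continuous fun q : (ℝ × ℝ) × ℝ => Γ (0, q.1) q.2 := by
    have h := continuous_uncurry_of_isIntegralCurve hZ hΓ hΓ₀
    exact h.comp (f := fun q : (ℝ × ℝ) × ℝ => (((0 : ℝ), q.1), q.2)) (by fun_prop)
  have hret : ∀ s, ∃ τ, s ∈ U → (0 < τ ∧ τ ≤ T₀) ∧ (Γ (0, s) τ).1 = 0 ∧
      (∀ t ∈ Ioo 0 τ, 0 < (Γ (0, s) t).1) ∧ (Z (Γ (0, s) τ)).1 < 0 ∧
      ∀ t ∈ Ioo 0 (2 * τ), (Γ (0, s) t).1 = 0 → (Z (Γ (0, s) t)).1 < 0 := by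
    intro s
    by_cases hs : s ∈ U
    · obtain ⟨t₁, ht₁, hneg⟩ := (hT₀ s hs _ (hΓ _) (hΓ₀ _)).2
      obtain ⟨τ, hτ, h⟩ := hZr.exists_half_period hZ (hΓ (0, s)) (by rw [hΓ₀])
        (by rw [hΓ₀]; exact hup s hs) ht₁.1 hneg
      exact ⟨τ, fun _ => ⟨⟨hτ.1, hτ.2.le.trans ht₁.2⟩, h⟩⟩
    · exact ⟨0, fun h => absurd h hs⟩
  choose τ hτ using hret
  have hper : ∀ s ∈ U, Function.Periodic (Γ (0, s)) (2 * τ s) := fun s hs =>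
    hZr.periodic hZ (hΓ _) (by rw [hΓ₀]) (hτ s hs).2.1
  have hτpos : ∀ s ∈ U, 0 < τ s := fun s hs => (hτ s hs).1.1
  -- an upward crossing of the plane happens only at the initial point
  have hcross : ∀ s ∈ U, ∀ t, (Γ (0, s) t).1 = 0 → 0 < (Z (Γ (0, s) t)).1 →
      Γ (0, s) t = (0, s) := by
    intro s hs t h1 h2
    obtain ⟨r, hr, hrt⟩ := (hper s hs).exists_mem_Ico₀ (by linarith [hτpos s hs]) t
    rw [hrt] at h1 h2 ⊢
    rcases hr.1.eq_or_lt with h | h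
    · rw [← h, hΓ₀]
    · exact absurd h2 (not_lt.2 ((hτ s hs).2.2.2.2 r ⟨h, hr.2⟩ h1).le)
  have hagree : ∀ s ∈ U, ∀ t, Z (Γ (0, s) t) = X (Γ (0, s) t) := by
    intro s hs t
    have hpos := (hT₀ s hs _ (hΓ _) (hΓ₀ _)).1
    obtain ⟨r, hr, hrt⟩ := (hper s hs).exists_mem_Ico (by linarith [hτpos s hs]) t (-τ s)
    rw [hrt]
    have hle := (hτ s hs).1.2
    rcases le_total 0 r with h | h
    · exact hpos r ⟨h, by linarith [hr.2]⟩
    · have hsym := hZr.apply_sub_eq hZ (hΓ (0, s)) (τ := 0) (by rw [hΓ₀]) (-r)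
      rw [zero_sub, neg_neg, zero_add] at hsym
      rw [hsym, hZr, hXr, hpos (-r) ⟨by linarith, by linarith [hr.1]⟩]
  have hfun : (fun s : ℝ × ℝ => Γ (0, s) 0) = fun s => ((0 : ℝ), s) := funext fun s => hΓ₀ _
  refine ⟨U, fun s => Γ (0, s), fun s => 2 * τ s, hU, hUne, fun s hs => ⟨fun t => ?_, ?_,
    hper s hs, fun t ht h => ?_⟩, hcont.continuousOn, ?_, ?_, fun s hs a c h => ?_,
    fun s hs s' hs' hne => ?_⟩
  · have h : HasDerivAt (Γ (0, s)) (Z (Γ (0, s) t)) t := hΓ (0, s) t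
    rwa [hagree s hs t] at h
  · linarith [hτpos s hs]
  · replace h : Γ (0, s) t = (0, s) := h.trans (hΓ₀ _)
    have h1 : (Γ (0, s) t).1 = 0 := by rw [h]
    have h2 := (hτ s hs).2.2.2.2 t ht h1
    rw [h] at h2
    exact lt_asymm h2 (hup s hs)
  · refine continuousOn_const.mul (continuousOn_first_zero
      (f := fun s t => (Γ (0, s) t).1) (d := fun s t => (Z (Γ (0, s) t)).1) hcont.fst
      (hZ.continuous.comp hcont).fst (fun s t => ?_) (fun s => ?_) (fun s hs => ?_) hτpos
      (fun s hs => (hτ s hs).2.1) (fun s hs => (hτ s hs).2.2.1) fun s hs => (hτ s hs).2.2.2.1)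
    · exact (ContinuousLinearMap.fst ℝ ℝ (ℝ × ℝ)).hasFDerivAt.comp_hasDerivAt t (hΓ (0, s) t)
    · simp only [hΓ₀]
    · simp only [hΓ₀]
      exact hup s hs
  · rw [hfun]
    exact (contDiff_const.prodMk contDiff_id).contDiffOn
  · have hfd : HasFDerivAt (fun s : ℝ × ℝ => ((0 : ℝ), s))
        (ContinuousLinearMap.inr ℝ ℝ (ℝ × ℝ)) s :=
      (ContinuousLinearMap.inr ℝ ℝ (ℝ × ℝ)).hasFDerivAt
    have hX := hup s hs
    have hag := hagree s hs 0
    rw [hΓ₀] at hag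
    rw [hag] at hX
    simp only [hΓ₀, hfd.fderiv] at h
    have hc : c = 0 := by simpa [hX.ne'] using congrArg Prod.fst h
    refine ⟨?_, hc⟩
    simpa [hc] using congrArg Prod.snd h
  · rw [Set.disjoint_left]
    rintro _ ⟨t, rfl⟩ ⟨t', ht'⟩
    have hsh := ((hΓ (0, s')).shift t').eq_of_lipschitzWith hZ ((hΓ (0, s)).shift t) (t₀ := 0)
      (by simpa using ht')
    have h0 := congrFun hsh (-t')
    simp only [neg_add_cancel, hΓ₀] at h0
    have h1 := hcross s hs (-t' + t) (by rw [← h0]) (by rw [← h0]; exact hup s' hs')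
    rw [← h0] at h1
    exact hne (Prod.ext_iff.1 h1).2.symm

end Reversible

/-! ### Cutting off a field -/

section Cutoff

/-- A smooth function with values in `[0, 1]` that is `1` on the ball of radius `R`, vanishes far
away, and is invariant under the reflection. -/
noncomputable def cutoff (R : ℝ) (x : ℝ × ℝ × ℝ) : ℝ :=
  smoothTransition (3 * R ^ 2 + 1 - (x.1 ^ 2 + x.2.1 ^ 2 + x.2.2 ^ 2))

theorem contDiff_cutoff (R : ℝ) : ContDiff ℝ 1 (cutoff R) :=
  smoothTransition.contDiff.comp (n := ((1 : ℕ∞) : WithTop ℕ∞)) (by fun_prop)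

theorem cutoff_eq_one {R : ℝ} {x : ℝ × ℝ × ℝ} (hx : ‖x‖ ≤ R) : cutoff R x = 1 := by
  apply smoothTransition.one_of_one_le
  rw [norm_prod_le_iff, norm_prod_le_iff] at hx
  obtain ⟨h1, h2, h3⟩ := hx
  rw [norm_eq_abs] at h1 h2 h3
  have := sq_le_sq' (abs_le.1 h1).1 (abs_le.1 h1).2
  have := sq_le_sq' (abs_le.1 h2).1 (abs_le.1 h2).2
  have := sq_le_sq' (abs_le.1 h3).1 (abs_le.1 h3).2
  linarith

theorem hasCompactSupport_cutoff (R : ℝ) : HasCompactSupport (cutoff R) := by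
  refine HasCompactSupport.of_support_subset_isCompact
    (isCompact_closedBall 0 (√(3 * R ^ 2 + 1))) fun x hx => ?_
  have hlt : x.1 ^ 2 + x.2.1 ^ 2 + x.2.2 ^ 2 ≤ 3 * R ^ 2 + 1 := by
    by_contra! h
    exact hx (smoothTransition.zero_of_nonpos (by linarith))
  rw [mem_closedBall_zero_iff, norm_prod_le_iff, norm_prod_le_iff]
  refine ⟨abs_le_sqrt ?_, abs_le_sqrt ?_, abs_le_sqrt ?_⟩ <;> nlinarith

/-- A priori estimates suffice for a two-parameter family: the estimates are asked for all
multiples `χ • X` with `0 ≤ χ ≤ 1`, so that they apply to a complete cut-off of `X` and show that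
the cut-off is not noticed. -/
theorem hasTwoParameterFamilyOfPeriodicSolutions_of_estimates
    {X : ℝ × ℝ × ℝ → ℝ × ℝ × ℝ} (hX : ContDiff ℝ 1 X) (hXr : IsReversible X)
    {U : Set (ℝ × ℝ)} (hU : IsOpen U) (hUne : U.Nonempty) (hup : ∀ s ∈ U, 0 < (X (0, s)).1)
    {T₀ R : ℝ} (hT₀ : 0 ≤ T₀)
    (hest : ∀ χ : ℝ × ℝ × ℝ → ℝ, Continuous χ → (∀ x, 0 ≤ χ x) → (∀ x, χ x ≤ 1) →
      ∀ s ∈ U, ∀ γ : ℝ → ℝ × ℝ × ℝ, IsIntegralCurve γ (fun _ x => χ x • X x) → γ 0 = (0, s) →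
        (∀ t ∈ Icc 0 T₀, ‖γ t‖ ≤ R) ∧
        ((∀ t ∈ Icc 0 T₀, χ (γ t) = 1) → ∃ t ∈ Icc 0 T₀, (γ t).1 < 0)) :
    HasTwoParameterFamilyOfPeriodicSolutions X := by
  have hZc : ContDiff ℝ 1 fun x => cutoff R x • X x := (contDiff_cutoff R).smul hX
  have hZs : HasCompactSupport fun x => cutoff R x • X x := (hasCompactSupport_cutoff R).smul_right
  obtain ⟨K, hK⟩ := hZc.lipschitzWith_of_hasCompactSupport hZs one_ne_zero
  obtain ⟨L, hL⟩ := hZs.exists_bound_of_continuous hZc.continuous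
  have hL' : ∀ x, ‖cutoff R x • X x‖ ≤ L.toNNReal := fun x => (hL x).trans (le_coe_toNNReal L)
  have hZr : IsReversible fun x => cutoff R x • X x := fun x => by
    have hχ : cutoff R (reflection x) = cutoff R x := by simp [cutoff]
    simp only [hχ, hXr x, map_smul, smul_neg]
  have hone : ∀ s ∈ U, ∀ γ : ℝ → ℝ × ℝ × ℝ, IsIntegralCurve γ (fun _ x => cutoff R x • X x) →
      γ 0 = (0, s) → (∀ t ∈ Icc 0 T₀, cutoff R (γ t) = 1) ∧ ∃ t ∈ Icc 0 T₀, (γ t).1 < 0 := by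
    intro s hs γ hγ hγ₀
    obtain ⟨h1, h2⟩ := hest (cutoff R) (contDiff_cutoff R).continuous
      (fun x => smoothTransition.nonneg _) (fun x => smoothTransition.le_one _) s hs γ hγ hγ₀
    have h3 : ∀ t ∈ Icc 0 T₀, cutoff R (γ t) = 1 := fun t ht => cutoff_eq_one (h1 t ht)
    exact ⟨h3, h2 h3⟩
  refine hasTwoParameterFamilyOfPeriodicSolutions_of_isReversible hK hL' hZr hXr hU hUne
    (fun s hs => ?_) (T₀ := T₀) fun s hs γ hγ hγ₀ => ?_
  · obtain ⟨γ, hγ₀, hγ⟩ := exists_isIntegralCurve_of_lipschitzWith_of_bounded hK hL' (0, s)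
    have h := (hone s hs γ hγ hγ₀).1 0 ⟨le_rfl, hT₀⟩
    rw [hγ₀] at h
    simpa [h] using hup s hs
  · obtain ⟨h1, h2⟩ := hone s hs γ hγ hγ₀
    exact ⟨fun t ht => by simp [h1 t ht], h2⟩

end Cutoff

/-! ### A perturbed harmonic oscillator -/

section Oscillator

/-- A harmonic oscillator of frequency `ν` with a force `B`, run by a clock `c` of speed `σ`: in
coordinates rotating with the clock its state moves with speed at most `|σ * B|`. -/
theorem abs_rotating_coordinates_le {ν C T : ℝ} {x p c σ B : ℝ → ℝ}
    (hx : ∀ t, HasDerivAt x (σ t * p t) t)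
    (hp : ∀ t, HasDerivAt p (σ t * (-ν ^ 2 * x t + B t)) t) (hc : ∀ t, HasDerivAt c (σ t) t)
    (hB : ∀ t ∈ Icc 0 T, |σ t * B t| ≤ C) (hx₀ : x 0 = 0) (hc₀ : c 0 = 0) {t : ℝ}
    (ht : t ∈ Icc 0 T) :
    |p t * sin (ν * c t) - ν * x t * cos (ν * c t)| ≤ C * t ∧
      |p t * cos (ν * c t) + ν * x t * sin (ν * c t) - p 0| ≤ C * t := by
  have hνc : ∀ t, HasDerivAt (fun t => ν * c t) (ν * σ t) t := fun t => (hc t).const_mul ν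
  have hsin := fun t => (hνc t).sin
  have hcos := fun t => (hνc t).cos
  have hu : ∀ t, HasDerivAt (fun t => p t * sin (ν * c t) - ν * x t * cos (ν * c t))
      (σ t * B t * sin (ν * c t)) t := fun t => by
    refine (((hp t).mul (hsin t)).sub (((hx t).const_mul ν).mul (hcos t))).congr_deriv ?_
    ring
  have hw : ∀ t, HasDerivAt (fun t => p t * cos (ν * c t) + ν * x t * sin (ν * c t))
      (σ t * B t * cos (ν * c t)) t := fun t => by
    refine (((hp t).mul (hcos t)).add (((hx t).const_mul ν).mul (hsin t))).congr_deriv ?_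
    ring
  have key : ∀ y z : ℝ, |z| ≤ 1 → |y| ≤ C → ‖y * z‖ ≤ C := fun y z hz hy => by
    rw [norm_mul, norm_eq_abs, norm_eq_abs]
    nlinarith [abs_nonneg y, abs_nonneg z]
  have h1 := norm_image_sub_le_of_norm_deriv_le_segment'
    (fun t (_ : t ∈ Icc 0 T) => (hu t).hasDerivWithinAt)
    (fun t ht => key _ _ (abs_sin_le_one _) (hB t (Ico_subset_Icc_self ht))) t ht
  have h2 := norm_image_sub_le_of_norm_deriv_le_segment'
    (fun t (_ : t ∈ Icc 0 T) => (hw t).hasDerivWithinAt)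
    (fun t ht => key _ _ (abs_cos_le_one _) (hB t (Ico_subset_Icc_self ht))) t ht
  simp only [hc₀, hx₀, mul_zero, sin_zero, cos_zero, mul_one, sub_zero, add_zero, norm_eq_abs]
    at h1 h2
  exact ⟨h1, h2⟩

theorem abs_le_of_rotating_coordinates {y z u w θ : ℝ} (hu : |y * sin θ - z * cos θ| ≤ u)
    (hw : |y * cos θ + z * sin θ| ≤ w) : |y| ≤ u + w ∧ |z| ≤ u + w := by
  have hsc := sin_sq_add_cos_sq θ
  have hmul : ∀ a b c : ℝ, |b| ≤ 1 → |a| ≤ c → |a * b| ≤ c := fun a b c hb ha => by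
    rw [abs_mul]
    nlinarith [abs_nonneg a, abs_nonneg b]
  constructor
  · rw [show y = (y * sin θ - z * cos θ) * sin θ + (y * cos θ + z * sin θ) * cos θ by
      linear_combination -y * hsc]
    exact (abs_add_le _ _).trans (add_le_add (hmul _ _ _ (abs_sin_le_one θ) hu)
      (hmul _ _ _ (abs_cos_le_one θ) hw))
  · rw [show z = -((y * sin θ - z * cos θ) * cos θ) + (y * cos θ + z * sin θ) * sin θ by
      linear_combination -z * hsc]
    refine (abs_add_le _ _).trans (add_le_add ?_ (hmul _ _ _ (abs_sin_le_one θ) hw))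
    rw [abs_neg]
    exact hmul _ _ _ (abs_cos_le_one θ) hu

end Oscillator

/-! ### The pendulum in momentum coordinates -/

section Pendulum

namespace ZieglerPendulum

/-- The entry `A₁₂` of the mass matrix in terms of `a = A₁₁` and the coupling `b`. -/
noncomputable def mass12 (a b φ : ℝ) : ℝ := a + b * cos φ

/-- The entry `A₂₂` of the mass matrix in terms of `a = A₁₁`, the coupling `b` and the
total mass term `M`. -/
noncomputable def mass22 (a M b φ : ℝ) : ℝ := M + a + 2 * b * cos φ

/-- The determinant of the mass matrix. -/
noncomputable def massDet (a M b φ : ℝ) : ℝ := a * M - b ^ 2 * cos φ ^ 2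

/-- The reduced field of the pendulum in terms of `a = m₁ l₁² + m₃ l₃²`,
`M = (m₁ + m₂ + m₃) l₂²`, `b = (m₁ l₁ - m₃ l₃) l₂` and `f = F l₁`, solved for the accelerations by
Cramer's rule. -/
noncomputable def pendulumField (a M b f k : ℝ) (x : ℝ × ℝ × ℝ) : ℝ × ℝ × ℝ :=
  (x.2.1,
    (mass22 a M b x.1 * (-k * x.1 - b * x.2.2 ^ 2 * sin x.1)
      - mass12 a b x.1 * (-f * sin x.1 + b * x.2.1 * (x.2.1 + 2 * x.2.2) * sin x.1))
      / massDet a M b x.1,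
    (a * (-f * sin x.1 + b * x.2.1 * (x.2.1 + 2 * x.2.2) * sin x.1)
      - mass12 a b x.1 * (-k * x.1 - b * x.2.2 ^ 2 * sin x.1)) / massDet a M b x.1)

/-- The square root of the effective mass of the relative angle. -/
noncomputable def rootMass (a M b φ : ℝ) : ℝ := √(massDet a M b φ / mass22 a M b φ)

/-- The momentum conjugate to the cyclic angle. -/
noncomputable def angularMomentum (a M b : ℝ) (x : ℝ × ℝ × ℝ) : ℝ :=
  mass12 a b x.1 * x.2.1 + mass22 a M b x.1 * x.2.2

/-- The part of the effective force on the relative angle, expressed by the angular momentum,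
that does not come from the spring. -/
noncomputable def effectiveForce (a M b f : ℝ) (x : ℝ × ℝ × ℝ) : ℝ :=
  sin x.1 * (f * mass12 a b x.1 / mass22 a M b x.1
    - b * angularMomentum a M b x ^ 2 / mass22 a M b x.1 ^ 2)

variable {a M b f k : ℝ}

theorem sub_sq_le_massDet (φ : ℝ) : a * M - b ^ 2 ≤ massDet a M b φ := by
  unfold massDet
  nlinarith [cos_sq_le_one φ, sq_nonneg b]

theorem massDet_pos (hb : b ^ 2 < a * M) (φ : ℝ) : 0 < massDet a M b φ :=
  (sub_pos.2 hb).trans_le (sub_sq_le_massDet φ)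

theorem le_mass22 (ha : 0 < a) (φ : ℝ) : (a * M - b ^ 2) / a ≤ mass22 a M b φ := by
  rw [div_le_iff₀ ha]
  refine (sub_sq_le_massDet φ).trans ?_
  unfold massDet mass22
  nlinarith [sq_nonneg (a + b * cos φ)]

theorem mass22_pos (ha : 0 < a) (hb : b ^ 2 < a * M) (φ : ℝ) : 0 < mass22 a M b φ :=
  (div_pos (sub_pos.2 hb) ha).trans_le (le_mass22 ha φ)

theorem rootMass_pos (ha : 0 < a) (hb : b ^ 2 < a * M) (φ : ℝ) : 0 < rootMass a M b φ :=
  sqrt_pos.2 (div_pos (massDet_pos hb φ) (mass22_pos ha hb φ))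

theorem abs_mul_cos_le (b φ : ℝ) : |b * cos φ| ≤ |b| := by
  rw [abs_mul]
  exact mul_le_of_le_one_right (abs_nonneg b) (abs_cos_le_one φ)

theorem abs_mass12_le (ha : 0 < a) (φ : ℝ) : |mass12 a b φ| ≤ a + |b| :=
  (abs_add_le _ _).trans (add_le_add (abs_of_pos ha).le (abs_mul_cos_le b φ))

theorem exists_rootMass_bounds (ha : 0 < a) (hb : b ^ 2 < a * M) :
    ∃ r₀ r₁ : ℝ, 0 < r₀ ∧ ∀ φ, r₀ ≤ rootMass a M b φ ∧ rootMass a M b φ ≤ r₁ := by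
  have hd : 0 < a * M - b ^ 2 := sub_pos.2 hb
  have hM : 0 < M := pos_of_mul_pos_right ((sq_nonneg b).trans_lt hb) ha.le
  have hA : 0 < M + a + 2 * |b| := by positivity
  refine ⟨√((a * M - b ^ 2) / (M + a + 2 * |b|)), √(a * M / ((a * M - b ^ 2) / a)),
    sqrt_pos.2 (div_pos hd hA), fun φ => ⟨sqrt_le_sqrt ?_, sqrt_le_sqrt ?_⟩⟩
  · refine div_le_div₀ (massDet_pos hb φ).le (sub_sq_le_massDet φ) (mass22_pos ha hb φ) ?_
    unfold mass22
    linarith [(abs_le.1 (abs_mul_cos_le b φ)).2]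
  · refine div_le_div₀ (by positivity) ?_ (div_pos hd ha) (le_mass22 ha φ)
    unfold massDet
    nlinarith [sq_nonneg (b * cos φ)]

theorem isReversible_pendulumField : IsReversible (pendulumField a M b f k) := by
  rintro ⟨φ, v, w⟩
  simp only [pendulumField, reflection_apply, mass12, mass22, massDet, cos_neg, sin_neg,
    Prod.neg_mk, Prod.mk.injEq, neg_neg, true_and]
  constructor <;> ring

theorem contDiff_pendulumField (hb : b ^ 2 < a * M) : ContDiff ℝ 1 (pendulumField a M b f k) := by
  have hD : ∀ x : ℝ × ℝ × ℝ, massDet a M b x.1 ≠ 0 := fun x => (massDet_pos hb x.1).ne'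
  have hDc : ContDiff ℝ 1 fun x : ℝ × ℝ × ℝ => massDet a M b x.1 := by
    unfold massDet
    fun_prop
  refine contDiff_snd.fst.prodMk (ContDiff.prodMk (ContDiff.div ?_ hDc hD)
    (ContDiff.div ?_ hDc hD)) <;>
  · unfold mass12
    try unfold mass22
    fun_prop

section Curve

variable {c : ℝ → ℝ} {γ : ℝ → ℝ × ℝ × ℝ}

theorem hasDerivAt_angle {t : ℝ} (hγ : HasDerivAt γ (c t • pendulumField a M b f k (γ t)) t) :
    HasDerivAt (fun t => (γ t).1) (c t * (γ t).2.1) t :=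
  (ContinuousLinearMap.fst ℝ ℝ (ℝ × ℝ)).hasFDerivAt.comp_hasDerivAt t hγ

theorem hasDerivAt_velocities {t : ℝ}
    (hγ : HasDerivAt γ (c t • pendulumField a M b f k (γ t)) t) :
    HasDerivAt (fun t => (γ t).2.1) (c t * (pendulumField a M b f k (γ t)).2.1) t ∧
      HasDerivAt (fun t => (γ t).2.2) (c t * (pendulumField a M b f k (γ t)).2.2) t := by
  have h := (ContinuousLinearMap.snd ℝ ℝ (ℝ × ℝ)).hasFDerivAt.comp_hasDerivAt t hγ
  exact ⟨(ContinuousLinearMap.fst ℝ ℝ ℝ).hasFDerivAt.comp_hasDerivAt t h,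
    (ContinuousLinearMap.snd ℝ ℝ ℝ).hasFDerivAt.comp_hasDerivAt t h⟩

theorem hasDerivAt_angularMomentum (hb : b ^ 2 < a * M) {t : ℝ}
    (hγ : HasDerivAt γ (c t • pendulumField a M b f k (γ t)) t) :
    HasDerivAt (fun t => angularMomentum a M b (γ t)) (-(c t * f * sin (γ t).1)) t := by
  have hx := hasDerivAt_angle hγ
  obtain ⟨hv, hw⟩ := hasDerivAt_velocities hγ
  have hcos := hx.cos
  have h12 := (hcos.const_mul b).const_add a
  have h22 := (hcos.const_mul (2 * b)).const_add (M + a)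
  refine ((h12.mul hv).add (h22.mul hw)).congr_deriv ?_
  have hD := (massDet_pos hb (γ t).1).ne'
  simp only [pendulumField]
  field_simp
  simp only [massDet, mass12, mass22]
  ring

/-- The momentum of the relative angle obeys an oscillator equation: its quadratic velocity terms
combine with the change of the effective mass into a function of the angle and of the angular
momentum. -/
theorem hasDerivAt_rootMass_mul (ha : 0 < a) (hb : b ^ 2 < a * M) {t : ℝ}
    (hγ : HasDerivAt γ (c t • pendulumField a M b f k (γ t)) t) :
    HasDerivAt (fun t => rootMass a M b (γ t).1 * (γ t).2.1)
      (c t / rootMass a M b (γ t).1 * (-k * (γ t).1 + effectiveForce a M b f (γ t))) t := by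
  have hx := hasDerivAt_angle hγ
  obtain ⟨hv, -⟩ := hasDerivAt_velocities hγ
  have hcos := hx.cos
  have hD := (massDet_pos hb (γ t).1)
  have hA := (mass22_pos ha hb (γ t).1)
  have hDd := ((hcos.pow 2).const_mul (b ^ 2)).const_sub (a * M)
  have h22 := (hcos.const_mul (2 * b)).const_add (M + a)
  have hq := (hDd.div h22 hA.ne').sqrt (div_pos hD hA).ne'
  have hr := rootMass_pos ha hb (γ t).1
  have hrsq : rootMass a M b (γ t).1 ^ 2 = massDet a M b (γ t).1 / mass22 a M b (γ t).1 :=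
    sq_sqrt (div_pos hD hA).le
  refine (hq.mul hv).congr_deriv ?_
  change _ / (2 * rootMass a M b (γ t).1) * _ + rootMass a M b (γ t).1 * _ = _
  set r := rootMass a M b (γ t).1
  rw [div_mul_eq_mul_div, div_mul_eq_mul_div (c t) r, div_add' _ _ _ (by positivity),
    div_eq_div_iff (by positivity) hr.ne',
    show ∀ y z : ℝ, (y + r * z * (2 * r)) * r = (y + 2 * r ^ 2 * z) * r by intros; ring, hrsq]
  simp only [pendulumField, effectiveForce, angularMomentum]
  have hD' : a * M - b ^ 2 * cos (γ t).1 ^ 2 = massDet a M b (γ t).1 := rfl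
  have hA' : M + a + 2 * b * cos (γ t).1 = mass22 a M b (γ t).1 := rfl
  simp only [Pi.pow_apply, hD', hA']
  field_simp
  simp only [massDet, mass12, mass22]
  ring

end Curve

end ZieglerPendulum

end Pendulum

/-! ### A priori estimates for the pendulum -/

namespace ZieglerPendulum

section Estimates

variable {a M b f k : ℝ}

theorem abs_effectiveForce_le {α A J : ℝ} (hα : 0 < α) {x : ℝ × ℝ × ℝ}
    (h22 : α ≤ mass22 a M b x.1) (h12 : |mass12 a b x.1| ≤ A)
    (hJ : |angularMomentum a M b x| ≤ J) :
    |effectiveForce a M b f x| ≤ |f| * A / α + |b| * J ^ 2 / α ^ 2 := by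
  have hA : 0 ≤ A := (abs_nonneg _).trans h12
  have h22' : |mass22 a M b x.1| = mass22 a M b x.1 := abs_of_pos (hα.trans_le h22)
  unfold effectiveForce
  rw [abs_mul]
  refine (mul_le_of_le_one_left (abs_nonneg _) (abs_sin_le_one _)).trans ?_
  refine (abs_sub _ _).trans (add_le_add ?_ ?_)
  · rw [abs_div, abs_mul, h22']
    gcongr
  · rw [abs_div, abs_mul, abs_pow, abs_pow, h22']
    gcongr

/-- If the relative angle starts at `0` with a large velocity and the angular momentum starts near
`0`, then the motion is bounded by constants up to a time at which the angle has become negative.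
The angular momentum is bounded because its derivative `-f sin φ` is, so that the momentum of the
angle follows a harmonic oscillator with a bounded force, which a large amplitude outweighs. The
bound holds as well if the field is multiplied by a function with values in `[0, 1]`. -/
theorem exists_pendulum_estimates (ha : 0 < a) (hb : b ^ 2 < a * M) (hk : 0 < k) (f : ℝ) :
    ∃ T₀ R N : ℝ, 0 ≤ T₀ ∧ 0 < N ∧
      ∀ χ : ℝ × ℝ × ℝ → ℝ, Continuous χ → (∀ x, 0 ≤ χ x) → (∀ x, χ x ≤ 1) →
        ∀ s : ℝ × ℝ, s.1 ∈ Ioo N (N + 1) → |angularMomentum a M b (0, s)| < 1 →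
        ∀ γ : ℝ → ℝ × ℝ × ℝ, IsIntegralCurve γ (fun _ x => χ x • pendulumField a M b f k x) →
          γ 0 = (0, s) →
          (∀ t ∈ Icc 0 T₀, ‖γ t‖ ≤ R) ∧
          ((∀ t ∈ Icc 0 T₀, χ (γ t) = 1) → ∃ t ∈ Icc 0 T₀, (γ t).1 < 0) := by
  obtain ⟨r₀, r₁, hr₀, hr⟩ := exists_rootMass_bounds ha hb
  have hr₁ : 0 < r₁ := hr₀.trans_le ((hr 0).1.trans (hr 0).2)
  obtain ⟨α, hα, h22⟩ : ∃ α, 0 < α ∧ ∀ φ, α ≤ mass22 a M b φ :=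
    ⟨_, div_pos (sub_pos.2 hb) ha, le_mass22 ha⟩
  obtain ⟨A, h12⟩ : ∃ A, ∀ φ, |mass12 a b φ| ≤ A := ⟨_, abs_mass12_le ha⟩
  have hA : 0 ≤ A := (abs_nonneg _).trans (h12 0)
  have hν : 0 < √k := sqrt_pos.2 hk
  -- `T₀` is the time by which the clock has made at least three quarters of a turn
  obtain ⟨T₀, hT₀⟩ : ∃ T₀, T₀ = r₁ * (3 * π / 2 / √k) := ⟨_, rfl⟩
  have hT₀pos : 0 ≤ T₀ := by rw [hT₀]; positivity
  obtain ⟨J, hJdef⟩ : ∃ J, J = 1 + |f| * T₀ := ⟨_, rfl⟩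
  -- `C` bounds the force per unit of time
  obtain ⟨C, hC⟩ : ∃ C, C = 1 / r₀ * (|f| * A / α + |b| * J ^ 2 / α ^ 2) := ⟨_, rfl⟩
  have hC₀ : 0 ≤ C := by rw [hC]; positivity
  -- `N` makes the initial momentum of the angle exceed `C * T₀`, the most that the force can undo
  obtain ⟨N, hN⟩ : ∃ N, N = C * T₀ / r₀ + 1 := ⟨_, rfl⟩
  have hN₀ : 0 < N := by rw [hN]; positivity
  -- `Q` bounds the momentum of the angle and `√k` times the angle
  obtain ⟨Q, hQ⟩ : ∃ Q, Q = C * T₀ + (C * T₀ + r₁ * (N + 1)) := ⟨_, rfl⟩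
  have hQ₀ : 0 ≤ Q := by rw [hQ]; positivity
  have hJ₀ : 0 ≤ J := by rw [hJdef]; positivity
  refine ⟨T₀, Q / √k + Q / r₀ + (J + A * (Q / r₀)) / α, N, hT₀pos, hN₀, ?_⟩
  intro χ hχ hχ₀ hχ₁ s hs hsJ γ hγ hγ₀
  have hγc : Continuous γ := hγ.continuous
  have hr' : ∀ t, 0 < rootMass a M b (γ t).1 := fun t => rootMass_pos ha hb _
  obtain ⟨σ, hσ⟩ : ∃ σ : ℝ → ℝ, σ = fun t => χ (γ t) / rootMass a M b (γ t).1 := ⟨_, rfl⟩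
  have hσc : Continuous σ := by
    have h : Continuous fun t => rootMass a M b (γ t).1 := by
      have h1 : ∀ t, mass22 a M b (γ t).1 ≠ 0 := fun t => (mass22_pos ha hb _).ne'
      unfold rootMass
      refine (Continuous.div ?_ ?_ h1).sqrt
      · unfold massDet
        fun_prop
      · unfold mass22
        fun_prop
    rw [hσ]
    exact (hχ.comp hγc).div h fun t => (hr' t).ne'
  have hσabs : ∀ t, |σ t| ≤ 1 / r₀ := fun t => by
    simp only [hσ]
    rw [abs_of_nonneg (div_nonneg (hχ₀ _) (hr' t).le)]
    exact div_le_div₀ zero_le_one (hχ₁ _) hr₀ (hr _).1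
  have hJ : ∀ t ∈ Icc 0 T₀, |angularMomentum a M b (γ t)| ≤ J := by
    intro t ht
    have h := norm_image_sub_le_of_norm_deriv_le_segment' (C := |f|)
      (fun t (_ : t ∈ Icc 0 T₀) => (hasDerivAt_angularMomentum
        (c := fun t => χ (γ t)) hb (hγ t)).hasDerivWithinAt)
      (fun t _ => by
        rw [norm_neg, norm_mul, norm_mul, norm_eq_abs, norm_eq_abs, norm_eq_abs]
        have h1 : |χ (γ t)| ≤ 1 := by rw [abs_of_nonneg (hχ₀ _)]; exact hχ₁ _
        have h2 : |χ (γ t)| * |f| ≤ |f| := mul_le_of_le_one_left (abs_nonneg f) h1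
        exact (mul_le_of_le_one_right (by positivity) (abs_sin_le_one _)).trans h2) t ht
    rw [hγ₀, norm_eq_abs, sub_zero] at h
    have h1 := abs_sub_abs_le_abs_sub (angularMomentum a M b (γ t)) (angularMomentum a M b (0, s))
    have h2 : |f| * t ≤ |f| * T₀ := mul_le_mul_of_nonneg_left ht.2 (abs_nonneg f)
    rw [hJdef]
    linarith
  have hforce : ∀ t ∈ Icc 0 T₀, |σ t * effectiveForce a M b f (γ t)| ≤ C := by
    intro t ht
    rw [abs_mul, hC]
    exact mul_le_mul (hσabs t) (abs_effectiveForce_le hα (h22 _) (h12 _) (hJ t ht))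
      (abs_nonneg _) (by positivity)
  have hc : ∀ t, HasDerivAt (fun t => ∫ r in (0 : ℝ)..t, σ r) (σ t) t := fun t =>
    (hσc.integral_hasStrictDerivAt 0 t).hasDerivAt
  have hrot := fun t (ht : t ∈ Icc 0 T₀) => abs_rotating_coordinates_le (ν := √k)
    (x := fun t => (γ t).1) (p := fun t => rootMass a M b (γ t).1 * (γ t).2.1) (σ := σ)
    (B := fun t => effectiveForce a M b f (γ t))
    (fun t => (hasDerivAt_angle (c := fun t => χ (γ t)) (hγ t)).congr_deriv (by
      have := (hr' t).ne'
      simp only [hσ]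
      field_simp))
    (fun t => (hasDerivAt_rootMass_mul (c := fun t => χ (γ t)) ha hb (hγ t)).congr_deriv (by
      simp only [hσ, neg_mul, sq_sqrt hk.le])) hc hforce (by rw [hγ₀]) (by simp) ht
  have hP : rootMass a M b (γ 0).1 * (γ 0).2.1 = rootMass a M b 0 * s.1 := by rw [hγ₀]
  have hs₀ : 0 < s.1 := hN₀.trans hs.1
  have hP₁ : rootMass a M b 0 * s.1 ≤ r₁ * (N + 1) :=
    mul_le_mul (hr 0).2 hs.2.le hs₀.le hr₁.le
  have hP₀ : C * T₀ < rootMass a M b 0 * s.1 := by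
    have h1 : C * T₀ = r₀ * (C * T₀ / r₀) := by field_simp
    rw [h1]
    exact (mul_lt_mul_of_pos_left (by linarith [hs.1]) hr₀).trans_le
      (mul_le_mul_of_nonneg_right (hr 0).1 hs₀.le)
  have hPpos : 0 ≤ rootMass a M b 0 * s.1 := (by positivity : 0 ≤ C * T₀).trans hP₀.le
  simp only [hP] at hrot
  refine ⟨fun t ht => ?_, fun hone => ?_⟩
  · obtain ⟨h1, h2⟩ := hrot t ht
    have hCt : C * t ≤ C * T₀ := mul_le_mul_of_nonneg_left ht.2 hC₀
    obtain ⟨h3, h4⟩ := abs_le_of_rotating_coordinates (h1.trans hCt)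
      (w := C * T₀ + r₁ * (N + 1)) (by
        have := abs_sub_abs_le_abs_sub _ _ |>.trans h2
        rw [abs_of_nonneg hPpos] at this
        linarith)
    rw [← hQ] at h3 h4
    have hφ : |(γ t).1| ≤ Q / √k := by
      rw [le_div_iff₀ hν, mul_comm]
      rwa [abs_mul, abs_of_pos hν] at h4
    have hv : |(γ t).2.1| ≤ Q / r₀ := by
      rw [le_div_iff₀ hr₀, mul_comm]
      rw [abs_mul, abs_of_pos (hr' t)] at h3
      exact (mul_le_mul_of_nonneg_right (hr _).1 (abs_nonneg _)).trans h3
    have hw : |(γ t).2.2| ≤ (J + A * (Q / r₀)) / α := by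
      rw [le_div_iff₀ hα, mul_comm]
      have h5 : mass22 a M b (γ t).1 * (γ t).2.2 =
          angularMomentum a M b (γ t) - mass12 a b (γ t).1 * (γ t).2.1 := by
        unfold angularMomentum
        ring
      calc α * |(γ t).2.2| ≤ |mass22 a M b (γ t).1| * |(γ t).2.2| :=
            mul_le_mul_of_nonneg_right ((h22 _).trans (le_abs_self _)) (abs_nonneg _)
        _ = |angularMomentum a M b (γ t) - mass12 a b (γ t).1 * (γ t).2.1| := by
            rw [← abs_mul, h5]
        _ ≤ J + A * (Q / r₀) := by
            refine (abs_sub _ _).trans (add_le_add (hJ t ht) ?_)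
            rw [abs_mul]
            exact mul_le_mul (h12 _) hv (abs_nonneg _) hA
    have e1 : 0 ≤ Q / √k := by positivity
    have e2 : 0 ≤ Q / r₀ := by positivity
    have e3 : 0 ≤ (J + A * (Q / r₀)) / α := by positivity
    rw [norm_prod_le_iff, norm_prod_le_iff]
    refine ⟨hφ.trans ?_, hv.trans ?_, hw.trans ?_⟩ <;> linarith
  · -- after three quarters of a turn of the clock the oscillator is near its negative extreme
    have hclock : 3 * π / 2 / √k ≤ ∫ r in (0 : ℝ)..T₀, σ r := by
      have h1 : ∫ _ in (0 : ℝ)..T₀, 1 / r₁ = 3 * π / 2 / √k := by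
        rw [intervalIntegral.integral_const, hT₀, smul_eq_mul, sub_zero]
        field_simp
      rw [← h1]
      refine intervalIntegral.integral_mono_on hT₀pos (by simp) (hσc.intervalIntegrable _ _)
        fun t ht => ?_
      simp only [hσ, hone t ht]
      exact one_div_le_one_div_of_le (hr' t) (hr _).2
    obtain ⟨t, ht, htc⟩ := intermediate_value_Icc hT₀pos
      (fun t _ => (hc t).continuousAt.continuousWithinAt)
      (show 3 * π / 2 / √k ∈ Icc (∫ r in (0 : ℝ)..0, σ r) (∫ r in (0 : ℝ)..T₀, σ r) from
        ⟨by rw [intervalIntegral.integral_same]; positivity, hclock⟩)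
    refine ⟨t, ht, ?_⟩
    have h := (hrot t ht).2
    simp only at htc
    have hturn : √k * (3 * π / 2 / √k) = π / 2 + π := by
      field_simp
      ring
    rw [htc, hturn, sin_add_pi, cos_add_pi, sin_pi_div_two, cos_pi_div_two] at h
    have hCt : C * t ≤ C * T₀ := mul_le_mul_of_nonneg_left ht.2 hC₀
    have h1 := (abs_le.1 h).1
    by_contra! hneg
    have : 0 ≤ √k * (γ t).1 := mul_nonneg hν.le hneg
    linarith

theorem hasTwoParameterFamily_pendulumField (ha : 0 < a) (hb : b ^ 2 < a * M) (hk : 0 < k)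
    (f : ℝ) :
    HasTwoParameterFamilyOfPeriodicSolutions (pendulumField a M b f k) := by
  obtain ⟨T₀, R, N, hT₀, hN, hest⟩ := exists_pendulum_estimates ha hb hk f
  have hJc : Continuous fun s : ℝ × ℝ => |angularMomentum a M b (0, s)| := by
    unfold angularMomentum mass12 mass22
    fun_prop
  have hA : mass22 a M b 0 ≠ 0 := (mass22_pos ha hb 0).ne'
  refine hasTwoParameterFamilyOfPeriodicSolutions_of_estimates (contDiff_pendulumField hb)
    isReversible_pendulumField
    (U := {s | s.1 ∈ Ioo N (N + 1)} ∩ {s | |angularMomentum a M b (0, s)| < 1})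
    ((isOpen_Ioo.preimage continuous_fst).inter (isOpen_lt hJc continuous_const))
    ⟨(N + 1 / 2, -(mass12 a b 0 * (N + 1 / 2)) / mass22 a M b 0), ?_, ?_⟩
    (fun s hs => hN.trans hs.1.1) hT₀
    (fun χ h1 h2 h3 s hs => hest χ h1 h2 h3 s hs.1 hs.2)
  · constructor <;> simp only <;> linarith
  · simp only [mem_ofPred_eq, angularMomentum]
    rw [mul_div_cancel₀ _ hA, add_neg_cancel, abs_zero]
    exact one_pos

end Estimates

/-! ### The reduced equations of motion -/

section ReducedField

/-- Inverting the mass matrix: the equations of motion in terms of the Schur complements of the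
mass matrix agree with those given by Cramer's rule. -/
theorem reducedField_eq_pendulumField {m₁ m₂ m₃ l₁ l₂ l₃ : ℝ} (k₁ F : ℝ)
    (ha : 0 < m₁ * l₁ ^ 2 + m₃ * l₃ ^ 2)
    (hb : ((m₁ * l₁ - m₃ * l₃) * l₂) ^ 2 <
      (m₁ * l₁ ^ 2 + m₃ * l₃ ^ 2) * ((m₁ + m₂ + m₃) * l₂ ^ 2)) :
    reducedField m₁ m₂ m₃ l₁ l₂ l₃ k₁ F =
      pendulumField (m₁ * l₁ ^ 2 + m₃ * l₃ ^ 2) ((m₁ + m₂ + m₃) * l₂ ^ 2)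
        ((m₁ * l₁ - m₃ * l₃) * l₂) (F * l₁) k₁ := by
  funext ⟨φ, v, w⟩
  have hD := (massDet_pos hb φ).ne'
  have hA := (mass22_pos ha hb φ).ne'
  have e11 : massA11 m₁ m₃ l₁ l₃ = m₁ * l₁ ^ 2 + m₃ * l₃ ^ 2 := rfl
  have e12 : massA12 m₁ m₃ l₁ l₂ l₃ φ =
      mass12 (m₁ * l₁ ^ 2 + m₃ * l₃ ^ 2) ((m₁ * l₁ - m₃ * l₃) * l₂) φ := by
    unfold massA12 mass12
    ring
  have e22 : massA22 m₁ m₂ m₃ l₁ l₂ l₃ φ = mass22 (m₁ * l₁ ^ 2 + m₃ * l₃ ^ 2)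
      ((m₁ + m₂ + m₃) * l₂ ^ 2) ((m₁ * l₁ - m₃ * l₃) * l₂) φ := by
    unfold massA22 mass22
    ring
  have er1 : rhs1 m₁ m₃ l₁ l₂ l₃ k₁ φ w =
      -k₁ * φ - (m₁ * l₁ - m₃ * l₃) * l₂ * w ^ 2 * sin φ := by
    unfold rhs1
    ring
  have er2 : rhs2 m₁ m₃ l₁ l₂ l₃ F φ v w =
      -(F * l₁) * sin φ + (m₁ * l₁ - m₃ * l₃) * l₂ * v * (v + 2 * w) * sin φ := by
    unfold rhs2
    ring
  simp only [reducedField, pendulumField, e11, e12, e22, er1, er2]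
  generalize m₁ * l₁ ^ 2 + m₃ * l₃ ^ 2 = a at *
  generalize (m₁ + m₂ + m₃) * l₂ ^ 2 = M at *
  generalize (m₁ * l₁ - m₃ * l₃) * l₂ = b at *
  have hdet : a * mass22 a M b φ - mass12 a b φ * mass12 a b φ = massDet a M b φ := by
    unfold mass22 mass12 massDet
    ring
  have h1 : a - mass12 a b φ * mass12 a b φ / mass22 a M b φ =
      massDet a M b φ / mass22 a M b φ := by
    rw [← hdet]
    field_simp
  have h2 : mass22 a M b φ - mass12 a b φ * mass12 a b φ / a = massDet a M b φ / a := by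
    rw [← hdet]
    field_simp
  rw [h1, h2, inv_div, inv_div]
  refine Prod.ext rfl (Prod.ext ?_ ?_)
  · simp only
    field_simp
  · simp only
    field_simp

end ReducedField

end ZieglerPendulum

theorem proposition6 (k₁ : ℝ) (hk₁ : 0 < k₁) :
    ∃ ε : ℝ, 0 < ε ∧
      ∀ m₁ m₂ m₃ l₁ l₂ l₃ F : ℝ,
        0 < m₁ → 0 < m₂ → 0 < m₃ → 0 < l₁ → 0 < l₂ → 0 < l₃ →
        |m₁ * l₁ - m₃ * l₃| < ε →
        HasTwoParameterFamilyOfPeriodicSolutions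
          (ZieglerPendulum.reducedField m₁ m₂ m₃ l₁ l₂ l₃ k₁ F) := by
  -- the estimates need no smallness, so any `ε` will do
  refine ⟨1, one_pos, fun m₁ m₂ m₃ l₁ l₂ l₃ F h1 h2 h3 h4 h5 h6 _ => ?_⟩
  have ha : 0 < m₁ * l₁ ^ 2 + m₃ * l₃ ^ 2 := by positivity
  -- Cauchy-Schwarz: `(m₁ l₁ - m₃ l₃)² ≤ (m₁ l₁² + m₃ l₃²) (m₁ + m₃)`
  have hb : ((m₁ * l₁ - m₃ * l₃) * l₂) ^ 2 <
      (m₁ * l₁ ^ 2 + m₃ * l₃ ^ 2) * ((m₁ + m₂ + m₃) * l₂ ^ 2) := by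
    have h : 0 < (m₂ * (m₁ * l₁ ^ 2 + m₃ * l₃ ^ 2) + m₁ * m₃ * (l₁ + l₃) ^ 2) * l₂ ^ 2 := by
      positivity
    linarith
  rw [ZieglerPendulum.reducedField_eq_pendulumField k₁ F ha hb]
  exact ZieglerPendulum.hasTwoParameterFamily_pendulumField ha hb hk₁ (F * l₁)
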